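/- Let $p$ be an odd prime and let $K$ be a finite extension of $\mathbb{Q}_p$, with normalised valuation $v_K$ and with maximal unramified extension $K^{nr}$ inside a fixed algebraic closure $\overline{K}$. Let $f\in K[x]$ be monic and square-free of degree $p$, with discriminant $\Delta$ (so that $X: y^2=f(x)$ is a hyperelliptic curve over $K$; nothing is assumed on its reduction). Suppose that 1. $f$ is irreducible over $K$, and 2. $\gcd(v_K(\Delta),\,p-1)=1$. Then the following two conditions hold: 1. the Galois group of the splitting field of $f$ over $K^{nr}$ is isomorphic to the Frobenius group $C_p\rtimes C_{p-1}=C_p\rtimes\operatorname{Aut}(C_p)$, and 2. $v_K(\Delta)$ is odd. -/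

import Mathlib

open Polynomial IsDedekindDomain

namespace LocalFieldExt

/-- An extension of `ℚ_[p]` is an algebra over the `p`-adic integers. -/
@[reducible] noncomputable def padicIntAlgebra (p : ℕ) [Fact p.Prime] (K : Type*) [Field K]
    [Algebra ℚ_[p] K] : Algebra ℤ_[p] K :=
  Algebra.compHom K (algebraMap ℤ_[p] ℚ_[p])

attribute [local instance] padicIntAlgebra

section ringOfIntegers

variable (p : ℕ) [Fact p.Prime] (K : Type*) [Field K] [Algebra ℚ_[p] K]

instance isScalarTower_padicInt : IsScalarTower ℤ_[p] ℚ_[p] K :=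
  IsScalarTower.of_algebraMap_eq fun _ ↦ rfl

/-- The ring of integers of `K`: the integral closure of `ℤ_[p]` in `K`. -/
noncomputable abbrev ringOfIntegers : Subalgebra ℤ_[p] K := integralClosure ℤ_[p] K

variable [FiniteDimensional ℚ_[p] K]

instance isFractionRing_ringOfIntegers : IsFractionRing (ringOfIntegers p K) K :=
  integralClosure.isFractionRing_of_finite_extension ℚ_[p] K

instance isDedekindDomain_ringOfIntegers : IsDedekindDomain (ringOfIntegers p K) :=
  integralClosure.isDedekindDomain ℤ_[p] ℚ_[p] K

variable {p K}

theorem isIntegral_iff_spectralNorm_le_one (x : K) :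
    IsIntegral ℤ_[p] x ↔ spectralNorm ℚ_[p] K x ≤ 1 := by
  have hx : IsIntegral ℚ_[p] x := Algebra.IsIntegral.isIntegral x
  rw [spectralNorm, spectralValue_le_one_iff (minpoly.monic hx)]
  constructor
  · intro h n
    rw [minpoly.isIntegrallyClosed_eq_field_fractions' ℚ_[p] h, coeff_map]
    exact ((minpoly ℤ_[p] x).coeff n).2
  · intro h
    have hl : minpoly ℚ_[p] x ∈ Polynomial.lifts (algebraMap ℤ_[p] ℚ_[p]) := by
      rw [Polynomial.lifts_iff_coeff_lifts]
      exact fun n ↦ ⟨⟨_, h n⟩, rfl⟩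
    obtain ⟨q, hq, -, hm⟩ := Polynomial.lifts_and_natDegree_eq_and_monic hl (minpoly.monic hx)
    refine ⟨q, hm, ?_⟩
    have := minpoly.aeval ℚ_[p] x
    rw [← hq, aeval_map_algebraMap] at this
    exact this

theorem isUnit_iff_spectralNorm_eq_one (x : ringOfIntegers p K) :
    IsUnit x ↔ spectralNorm ℚ_[p] K (x : K) = 1 := by
  have hmul : ∀ a b : K, spectralNorm ℚ_[p] K (a * b) =
      spectralNorm ℚ_[p] K a * spectralNorm ℚ_[p] K b :=
    fun a b ↦ map_mul (spectralMulAlgNorm ℚ_[p] K) a b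
  have hone : spectralNorm ℚ_[p] K (1 : K) = 1 := spectralNorm_one
  have hle : ∀ y : ringOfIntegers p K, spectralNorm ℚ_[p] K (y : K) ≤ 1 :=
    fun y ↦ (isIntegral_iff_spectralNorm_le_one _).1 y.2
  constructor
  · rintro h
    obtain ⟨y, hy⟩ := h.exists_right_inv
    have h1 := hmul x y
    rw [← Subalgebra.coe_mul, hy, Subalgebra.coe_one, hone] at h1
    nlinarith [hle x, hle y, spectralNorm_nonneg (K := ℚ_[p]) (x : K),
      spectralNorm_nonneg (K := ℚ_[p]) (y : K)]
  · intro h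
    have hx0 : (x : K) ≠ 0 := by
      intro h0
      rw [h0, spectralNorm_zero] at h
      exact zero_ne_one h
    have h1 := hmul x (x : K)⁻¹
    rw [mul_inv_cancel₀ hx0, hone, h, one_mul] at h1
    refine IsUnit.of_mul_eq_one
      (⟨(x : K)⁻¹, (isIntegral_iff_spectralNorm_le_one _).2 h1.symm.le⟩ : ringOfIntegers p K) ?_
    exact Subtype.ext (mul_inv_cancel₀ hx0)

variable (p K)

instance isLocalRing_ringOfIntegers : IsLocalRing (ringOfIntegers p K) := by
  refine IsLocalRing.of_nonunits_add fun a b ha hb ↦ ?_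
  have hle : ∀ y : ringOfIntegers p K, spectralNorm ℚ_[p] K (y : K) ≤ 1 :=
    fun y ↦ (isIntegral_iff_spectralNorm_le_one _).1 y.2
  rw [mem_nonunits_iff, isUnit_iff_spectralNorm_eq_one] at *
  have h := isNonarchimedean_spectralNorm (K := ℚ_[p]) (L := K) (a : K) (b : K)
  exact (h.trans_lt (max_lt (lt_of_le_of_ne (hle a) ha) (lt_of_le_of_ne (hle b) hb))).ne

theorem not_isField_ringOfIntegers : ¬ IsField (ringOfIntegers p K) := by
  intro h
  have hp : (p : ringOfIntegers p K) ≠ 0 := by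
    intro h0
    have h1 : ((p : ringOfIntegers p K) : K) = 0 := by rw [h0]; rfl
    have : (p : K) = 0 := by simpa using h1
    have hc : CharZero K := charZero_of_injective_algebraMap (algebraMap ℚ_[p] K).injective
    exact (Fact.out : p.Prime).ne_zero (by exact_mod_cast this)
  obtain ⟨y, hy⟩ := h.mul_inv_cancel hp
  have h2 := (isUnit_iff_spectralNorm_eq_one _).1 (IsUnit.of_mul_eq_one y hy)
  have h3 : (((p : ringOfIntegers p K)) : K) = algebraMap ℚ_[p] K (p : ℚ_[p]) := by simp
  rw [h3, spectralNorm_extends] at h2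
  exact (Padic.norm_p_lt_one (p := p)).ne h2

instance isDiscreteValuationRing_ringOfIntegers :
    IsDiscreteValuationRing (ringOfIntegers p K) :=
  ((IsDiscreteValuationRing.TFAE _ (not_isField_ringOfIntegers p K)).out 0 2).2
    (isDedekindDomain_ringOfIntegers p K)

/-- The normalised valuation `v_K : K → ℤ` of a finite extension `K` of `ℚ_[p]`: the additive
form of the valuation attached to the maximal ideal of the ring of integers. A uniformiser has
value `1`; the value at `0` is the junk value `0`. -/
noncomputable def normalizedVal (x : K) : ℤ :=
  -WithZero.log ((IsDiscreteValuationRing.maximalIdeal (ringOfIntegers p K)).valuation K x)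

/-- An extension `E` of `K` is unramified if its ring of integers (the integral closure in `E` of
the ring of integers of `K`) is unramified over the ring of integers of `K`. -/
def IsUnramifiedExt (E : Type*) [Field E] [Algebra K E] : Prop :=
  Algebra.FormallyUnramified (ringOfIntegers p K) (integralClosure (ringOfIntegers p K) E)

/-- The maximal unramified extension of `K` in its algebraic closure: the compositum
of all finite unramified subextensions. -/
noncomputable def maxUnramified : IntermediateField K (AlgebraicClosure K) :=
  ⨆ E : {E : IntermediateField K (AlgebraicClosure K) //
    FiniteDimensional K E ∧ IsUnramifiedExt p K E}, E.1

end ringOfIntegers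

/-- The Frobenius group `C_p ⋊ C_{p-1}`, that is, the semidirect product `C_p ⋊ Aut(C_p)` for the
tautological action of `Aut(C_p)` on `C_p`. -/
abbrev FrobeniusGroup (p : ℕ) : Type :=
  Multiplicative (ZMod p) ⋊[MonoidHom.id (MulAut (Multiplicative (ZMod p)))]
    MulAut (Multiplicative (ZMod p))

end LocalFieldExt

/-! Since `p - 1` is even, coprimality forces `v_K(Δ)` to be odd. Write `F` for `K^nr`. It is normal
over `K`, and a nontrivial normal subgroup of a primitive group is transitive, so `f`, of prime
degree, either stays irreducible over `F` or has all its roots there. In the second case each root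
difference has integral valuation, because `F` and `K` have the same value group; each difference
enters `Δ` twice, so `v_K(Δ)` would be even (`even_normalizedVal_discr_of_rootSet_subset`).

So `f` is irreducible over `F`, and its Galois group `G` contains an element `σ` of order `p`
permuting the roots cyclically. Galois elements are isometries, hence all root differences have one
absolute value `r` (`valuation_sub_eq`), with `r ^ (p(p-1)) = |Δ|`. The norm to `F` of a root
difference has absolute value `r ^ |G|`, an integral power of that of a uniformiser. Comparing
exponents, `p - 1` divides `v_K(Δ) |G|`, hence `|G|`.

Conversely `G` is small. The residue field of `F` is algebraically closed, so `G` acts trivially on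
residues. Dividing root differences by a fixed one and reducing identifies the roots with `𝔽_p`, on
which `G` acts by affine maps (`smul_eq_affine`). Thus `G` embeds in a group of order `p(p-1)`, and
this order divides `|G|`.

The facts on `F` come from roots of unity of order prime to `p`: they represent all nonzero residues
and generate `F`. -/

namespace LocalFieldExt

attribute [local instance] padicIntAlgebra

/-! ### The absolute value on algebraic extensions of `ℚ_[p]` -/

section absoluteValue

variable (p : ℕ) [Fact p.Prime] (L : Type*) [Field L] [Algebra ℚ_[p] L]
  [Algebra.IsAlgebraic ℚ_[p] L]

/-- The unique absolute value on an algebraic extension of `ℚ_[p]` extending the `p`-adic one. -/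
noncomputable def padicAbs : AbsoluteValue L ℝ where
  toFun := spectralNorm ℚ_[p] L
  map_mul' := map_mul (spectralMulAlgNorm ℚ_[p] L)
  nonneg' := spectralNorm_nonneg
  eq_zero' := fun _ ↦ map_eq_zero_iff_eq_zero (spectralMulAlgNorm ℚ_[p] L)
  add_le' := map_add_le_add (spectralMulAlgNorm ℚ_[p] L)

theorem padicAbs_apply (x : L) : padicAbs p L x = spectralNorm ℚ_[p] L x := rfl

theorem padicAbs_add_le_max (x y : L) :
    padicAbs p L (x + y) ≤ max (padicAbs p L x) (padicAbs p L y) :=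
  isNonarchimedean_spectralNorm x y

theorem padicAbs_natCast_prime_lt_one : padicAbs p L (p : L) < 1 := by
  rw [padicAbs_apply, show (p : L) = algebraMap ℚ_[p] L (p : ℚ_[p]) by simp, spectralNorm_extends]
  exact Padic.norm_p_lt_one

theorem padicAbs_natCast_eq_one {N : ℕ} (hN : N.Coprime p) : padicAbs p L (N : L) = 1 := by
  rw [padicAbs_apply, show (N : L) = algebraMap ℚ_[p] L (N : ℚ_[p]) by simp, spectralNorm_extends]
  exact Padic.norm_natCast_eq_one_iff.2 hN.symm

variable {L}

/-- The spectral norm depends only on the minimal polynomial over `ℚ_[p]`, which embeddings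
preserve. -/
theorem padicAbs_map {L' : Type*} [Field L'] [Algebra ℚ_[p] L'] [Algebra.IsAlgebraic ℚ_[p] L']
    (φ : L →ₐ[ℚ_[p]] L') (x : L) : padicAbs p L' (φ x) = padicAbs p L x := by
  rw [padicAbs_apply, padicAbs_apply, spectralNorm, spectralNorm,
    minpoly.algHom_eq φ φ.injective]

theorem isIntegral_iff_padicAbs_le_one (x : L) :
    IsIntegral ℤ_[p] x ↔ padicAbs p L x ≤ 1 := by
  have hx : IsIntegral ℚ_[p] x := Algebra.IsIntegral.isIntegral x
  rw [padicAbs_apply, spectralNorm, spectralValue_le_one_iff (minpoly.monic hx)]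
  constructor
  · intro h n
    rw [minpoly.isIntegrallyClosed_eq_field_fractions' ℚ_[p] h, coeff_map]
    exact ((minpoly ℤ_[p] x).coeff n).2
  · intro h
    have hl : minpoly ℚ_[p] x ∈ Polynomial.lifts (algebraMap ℤ_[p] ℚ_[p]) := by
      rw [Polynomial.lifts_iff_coeff_lifts]
      exact fun n ↦ ⟨⟨_, h n⟩, rfl⟩
    obtain ⟨q, hq, -, hm⟩ := Polynomial.lifts_and_natDegree_eq_and_monic hl (minpoly.monic hx)
    refine ⟨q, hm, ?_⟩
    have := minpoly.aeval ℚ_[p] x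
    rw [← hq, aeval_map_algebraMap] at this
    exact this

end absoluteValue

/-! ### Finite extensions of `ℚ_[p]`: residue field and uniformiser -/

section finite

variable (p : ℕ) [Fact p.Prime] (K : Type*) [Field K] [Algebra ℚ_[p] K] [FiniteDimensional ℚ_[p] K]

theorem isUnit_iff_padicAbs_eq_one (x : ringOfIntegers p K) :
    IsUnit x ↔ padicAbs p K (x : K) = 1 :=
  isUnit_iff_spectralNorm_eq_one x

theorem mem_maximalIdeal_iff_padicAbs_lt_one (x : ringOfIntegers p K) :
    x ∈ IsLocalRing.maximalIdeal (ringOfIntegers p K) ↔ padicAbs p K (x : K) < 1 := by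
  rw [IsLocalRing.mem_maximalIdeal, mem_nonunits_iff, isUnit_iff_padicAbs_eq_one]
  have := (isIntegral_iff_padicAbs_le_one p (x : K)).1 x.2
  exact ⟨fun h ↦ lt_of_le_of_ne this h, fun h ↦ h.ne⟩

instance finite_residueField_ringOfIntegers :
    Finite (IsLocalRing.ResidueField (ringOfIntegers p K)) := by
  have : Module.Finite ℤ_[p] (ringOfIntegers p K) :=
    IsIntegralClosure.finite ℤ_[p] ℚ_[p] K (ringOfIntegers p K)
  have : IsLocalHom (algebraMap ℤ_[p] (ringOfIntegers p K)) :=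
    ⟨fun a ha ↦ by
      rw [isUnit_iff_padicAbs_eq_one] at ha
      rw [PadicInt.isUnit_iff, ← ha]
      change _ = spectralNorm ℚ_[p] K (algebraMap ℚ_[p] K a)
      rw [spectralNorm_extends]
      rfl⟩
  exact IsLocalRing.ResidueField.finite_of_finite (R := ℤ_[p])
    (Finite.of_equiv (ZMod p) PadicInt.residueField.symm.toEquiv)

/-- Links the analytic and the ideal-theoretic valuation: both are determined by the exponent of a
uniformiser in a factorisation into a unit and a power, first for integers and then for quotients.
-/
theorem exists_uniformizer : ∃ ϖ : K, padicAbs p K ϖ < 1 ∧ 0 < padicAbs p K ϖ ∧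
    ∀ x : K, x ≠ 0 → padicAbs p K x = padicAbs p K ϖ ^ normalizedVal p K x := by
  set O := ringOfIntegers p K
  obtain ⟨π, hπ⟩ := IsDiscreteValuationRing.exists_irreducible O
  have hπ0 : (π : K) ≠ 0 := fun h ↦ hπ.ne_zero (Subtype.ext h)
  have hpos : 0 < padicAbs p K (π : K) := (padicAbs p K).pos hπ0
  have hmem : π ∈ IsLocalRing.maximalIdeal O := by
    rw [hπ.maximalIdeal_eq]; exact Ideal.mem_span_singleton_self π
  refine ⟨π, (mem_maximalIdeal_iff_padicAbs_lt_one p K π).1 hmem, hpos, ?_⟩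
  set v := (IsDiscreteValuationRing.maximalIdeal O)
  have hvπ : v.valuation K (π : K) = WithZero.exp (-1) := by
    change v.valuation K (algebraMap O K π) = _
    rw [HeightOneSpectrum.valuation_of_algebraMap]
    exact v.intValuation_singleton hπ.ne_zero hπ.maximalIdeal_eq
  have hvu (u : Oˣ) : v.valuation K (algebraMap O K u) = 1 := by
    rw [HeightOneSpectrum.valuation_of_algebraMap, HeightOneSpectrum.intValuation_eq_one_iff]
    exact fun h ↦ (IsLocalRing.mem_maximalIdeal _).1 h u.isUnit
  have hlog (a b : K) (ha : a ≠ 0) (hb : b ≠ 0) :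
      normalizedVal p K (a * b) = normalizedVal p K a + normalizedVal p K b := by
    rw [normalizedVal, normalizedVal, normalizedVal, map_mul, WithZero.log_mul]
    · ring
    · simpa using ha
    · simpa using hb
  have key (x : O) (hx : x ≠ 0) :
      padicAbs p K (x : K) = padicAbs p K (π : K) ^ normalizedVal p K (x : K) := by
    obtain ⟨n, u, rfl⟩ := IsDiscreteValuationRing.eq_unit_mul_pow_irreducible hx hπ
    have h1 : padicAbs p K ((u : O) : K) = 1 := (isUnit_iff_padicAbs_eq_one p K _).1 u.isUnit
    have h2 : normalizedVal p K (((u : O) * π ^ n : O) : K) = n := by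
      rw [normalizedVal]
      have : v.valuation K (((u : O) * π ^ n : O) : K) = WithZero.exp (-1) ^ n := by
        rw [Subalgebra.coe_mul, Subalgebra.coe_pow, map_mul, map_pow, hvπ]
        erw [hvu u]
        rw [one_mul]
      erw [this]
      rw [← WithZero.exp_nsmul, WithZero.log_exp]
      simp
    rw [h2, Subalgebra.coe_mul, Subalgebra.coe_pow, map_mul, map_pow, h1, one_mul, zpow_natCast]
  intro x hx
  obtain ⟨a, b, hb, hab⟩ := IsFractionRing.div_surjective (A := O) x
  have hb0 : b ≠ 0 := nonZeroDivisors.ne_zero hb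
  have hbK : (b : K) ≠ 0 := fun h ↦ hb0 (Subtype.ext h)
  have hax : (a : K) = x * b := by
    rw [← hab]; exact (div_mul_cancel₀ _ hbK).symm
  have haK : (a : K) ≠ 0 := by rw [hax]; exact mul_ne_zero hx hbK
  have ha := key a (fun h ↦ haK (by rw [h]; rfl))
  rw [hax, map_mul, hlog _ _ hx hbK, zpow_add₀ hpos.ne', key b hb0] at ha
  exact mul_right_cancel₀ (zpow_ne_zero _ hpos.ne') ha

end finite

/-! ### Roots of unity of order prime to `p` as residue representatives -/

section teichmuller

variable (p : ℕ) [Fact p.Prime] (L : Type*) [Field L] [Algebra ℚ_[p] L]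
  [Algebra.IsAlgebraic ℚ_[p] L]

/-- The roots of unity of order prime to `p`. -/
def primeToRootsOfUnity : Set L := {ζ | ∃ N : ℕ, N.Coprime p ∧ N ≠ 0 ∧ ζ ^ N = 1}

variable {L}

/-- Over `ℚ_[p]` the element `x` generates a finite extension, whose residue field has `q` elements,
`q` a power of `p`. Then `N = q - 1` works. -/
theorem exists_padicAbs_pow_sub_one_lt {x : L} (hx : padicAbs p L x = 1) :
    ∃ N : ℕ, N.Coprime p ∧ N ≠ 0 ∧ padicAbs p L (x ^ N - 1) < 1 := by
  let E := IntermediateField.adjoin ℚ_[p] {x}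
  have : FiniteDimensional ℚ_[p] E :=
    IntermediateField.adjoin.finiteDimensional (Algebra.IsIntegral.isIntegral x)
  let y : E := ⟨x, IntermediateField.mem_adjoin_simple_self _ x⟩
  have habs (z : E) : padicAbs p L (z : L) = padicAbs p E z := padicAbs_map p E.val z
  have hy : padicAbs p E y = 1 := by rw [← habs]; exact hx
  let O := ringOfIntegers p E
  let k := IsLocalRing.ResidueField O
  let z : O := ⟨y, (isIntegral_iff_padicAbs_le_one p y).2 hy.le⟩
  have := Fintype.ofFinite k
  have hpk : (p : k) = 0 := by
    rw [← map_natCast (IsLocalRing.residue O), IsLocalRing.residue_eq_zero_iff,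
      mem_maximalIdeal_iff_padicAbs_lt_one]
    exact padicAbs_natCast_prime_lt_one p E
  have : CharP k p := (CharP.charP_iff_prime_eq_zero Fact.out).2 hpk
  obtain ⟨n, hp, hn⟩ := FiniteField.card k p
  refine ⟨Fintype.card k - 1, ?_, ?_, ?_⟩
  · rw [Nat.coprime_comm, hp.coprime_iff_not_dvd]
    intro hd
    have h1 : p ∣ Fintype.card k := by rw [hn]; exact dvd_pow_self p n.ne_zero
    have h2 := Fintype.one_lt_card (α := k)
    have h3 : p ∣ Fintype.card k - (Fintype.card k - 1) := Nat.dvd_sub h1 hd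
    rw [Nat.sub_sub_self h2.le] at h3
    exact hp.one_lt.ne' (Nat.dvd_one.1 h3)
  · exact (Nat.sub_pos_of_lt Fintype.one_lt_card).ne'
  · have hz : IsLocalRing.residue O z ≠ 0 := by
      rw [Ne, IsLocalRing.residue_eq_zero_iff, mem_maximalIdeal_iff_padicAbs_lt_one]
      exact hy.not_lt
    have h1 := FiniteField.pow_card_sub_one_eq_one _ hz
    rw [← map_pow, ← sub_eq_zero, ← map_one (IsLocalRing.residue O), ← map_sub,
      IsLocalRing.residue_eq_zero_iff, mem_maximalIdeal_iff_padicAbs_lt_one, ← habs] at h1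
    exact h1

theorem exists_primeToRootsOfUnity_sub_lt [IsAlgClosed L] {x : L} (hx : padicAbs p L x ≤ 1) :
    ∃ ζ : L, (ζ = 0 ∨ ζ ∈ primeToRootsOfUnity p L) ∧ padicAbs p L (x - ζ) < 1 := by
  rcases hx.lt_or_eq with hx | hx
  · exact ⟨0, .inl rfl, by simpa using hx⟩
  obtain ⟨N, hN, hN0, h⟩ := exists_padicAbs_pow_sub_one_lt p hx
  have hspl : (X ^ N - 1 : L[X]).Splits := IsAlgClosed.splits _
  have hmon : (X ^ N - 1 : L[X]).Monic := by simpa using monic_X_pow_sub_C (1 : L) hN0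
  -- The product of all `x - ζ` over the `N`-th roots of unity is small, so some factor is.
  have h1 : x ^ N - 1 = ((X ^ N - 1 : L[X]).roots.map fun a ↦ x - a).prod := by
    have := congrArg (eval x) (hspl.eq_prod_roots_of_monic hmon)
    rw [eval_multiset_prod, Multiset.map_map] at this
    simpa using this
  by_contra! hcon
  rw [h1, map_multiset_prod, Multiset.map_map] at h
  refine h.not_ge (Multiset.one_le_prod fun a ha ↦ ?_)
  obtain ⟨ζ, hζ, rfl⟩ := Multiset.mem_map.1 ha
  refine hcon ζ (.inr ⟨N, hN, hN0, ?_⟩)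
  have := isRoot_of_mem_roots hζ
  simpa [sub_eq_zero] using this

end teichmuller

-- Criteria for, and rigidity of, unramified algebras

attribute [local instance] FractionRing.liftAlgebra FractionRing.isScalarTower_liftAlgebra in
theorem formallyUnramified_of_differentIdeal_eq_top {A B : Type*} [CommRing A] [CommRing B]
    [Algebra A B] [IsDedekindDomain A] [IsDedekindDomain B]
    [Module.IsTorsionFree A B] [Module.Finite A B] [CharZero A] (h : differentIdeal A B = ⊤) :
    Algebra.FormallyUnramified A B := by
  have : CharZero (FractionRing A) :=
    charZero_of_injective_algebraMap (IsFractionRing.injective A _)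
  rw [Algebra.formallyUnramified_iff_forall]
  intro q
  rw [← not_dvd_differentIdeal_iff, h, Ideal.dvd_iff_le]
  exact fun h ↦ q.2.ne_top (top_le_iff.1 h)

/-- Two algebra maps out of a finite formally unramified algebra into the unit ball of a
nonarchimedean field agree if they agree modulo the open unit ball. -/
theorem algHom_eq_of_abs_sub_lt {O A L : Type*} [CommRing O] [CommRing A] [Algebra O A]
    [Field L] [Algebra O L] [Module.Finite O A] [Algebra.FormallyUnramified O A]
    (w : AbsoluteValue L ℝ) (hw : ∀ x y, w (x + y) ≤ max (w x) (w y))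
    (hO : ∀ c : O, w (algebraMap O L c) ≤ 1) (φ ψ : A →ₐ[O] L) (hφ : ∀ a, w (φ a) ≤ 1)
    (hψ : ∀ a, w (ψ a) ≤ 1) (h : ∀ a, w (φ a - ψ a) < 1) : φ = ψ := by
  let B : Subalgebra O L :=
    { carrier := {x | w x ≤ 1}
      mul_mem' := fun {x y} hx hy ↦ by
        change w (x * y) ≤ 1
        rw [map_mul]
        exact mul_le_one₀ hx (w.nonneg y) hy
      add_mem' := fun {x y} hx hy ↦ (hw x y).trans (max_le hx hy)
      algebraMap_mem' := hO }
  let I (r : NNReal) : Ideal B :=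
    { carrier := {b | w (b : L) ≤ r}
      zero_mem' := by
        change w ((0 : B) : L) ≤ r
        simp
      add_mem' := fun {a b} ha hb ↦ (hw _ _).trans (max_le ha hb)
      smul_mem' := fun c b hb ↦ by
        change w ((c : L) * b) ≤ r
        rw [map_mul]
        exact (mul_le_of_le_one_left (w.nonneg _) c.2).trans hb }
  have hmemI (r : NNReal) (b : B) : b ∈ I r ↔ w (b : L) ≤ r := Iff.rfl
  have hpow (r : NNReal) (n : ℕ) : I r ^ n ≤ I (r ^ n) := by
    induction n with
    | zero =>
      intro b _
      rw [hmemI, pow_zero, NNReal.coe_one]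
      exact b.2
    | succ n ih =>
      rw [pow_succ, Ideal.mul_le]
      intro a ha b hb
      have h1 := ih ha
      rw [hmemI] at h1 hb ⊢
      rw [Subalgebra.coe_mul, map_mul, pow_succ, NNReal.coe_mul]
      exact mul_le_mul h1 hb (w.nonneg _) (NNReal.coe_nonneg _)
  obtain ⟨s, hs⟩ := (inferInstance : Module.Finite O A).1
  -- Finitely many module generators give a uniform bound `r < 1` on the discrepancy, so the powers
  -- of `I r` intersect in zero and uniqueness of lifts applies.
  let r : NNReal := s.sup fun a ↦ ⟨w (φ a - ψ a), w.nonneg _⟩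
  have hr : r < 1 := by
    refine (Finset.sup_lt_iff zero_lt_one).2 ?_
    exact fun a _ ↦ h a
  have hbot : ⨅ i, I r ^ i = ⊥ := by
    rw [eq_bot_iff]
    intro b hb
    have h1 (n : ℕ) : w (b : L) ≤ (r : ℝ) ^ n := by
      have := hpow r n ((Ideal.mem_iInf.1 hb) n)
      rwa [hmemI, NNReal.coe_pow] at this
    have h2 : w (b : L) ≤ 0 :=
      ge_of_tendsto' (tendsto_pow_atTop_nhds_zero_of_lt_one r.2 hr) h1
    exact Subtype.ext (w.eq_zero.1 (le_antisymm h2 (w.nonneg _)))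
  let φ' : A →ₐ[O] B := φ.codRestrict B hφ
  let ψ' : A →ₐ[O] B := ψ.codRestrict B hψ
  have hcongr (a : A) : φ' a - ψ' a ∈ I r := by
    have ha : a ∈ Submodule.span O (s : Set A) := hs ▸ Submodule.mem_top
    induction ha using Submodule.span_induction with
    | mem a ha =>
      exact (Finset.le_sup (f := fun a ↦ (⟨w (φ a - ψ a), w.nonneg _⟩ : NNReal)) ha : _)
    | zero => simp
    | add a b _ _ ha hb =>
      rw [map_add, map_add, add_sub_add_comm]
      exact add_mem ha hb
    | smul c a _ ha =>
      rw [map_smul, map_smul, ← smul_sub, Algebra.smul_def]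
      exact Ideal.mul_mem_left _ _ ha
  have heq : φ' = ψ' := Algebra.FormallyUnramified.ext_of_iInf (I r) hbot
    fun a ↦ Ideal.Quotient.eq.2 (hcongr a)
  ext a
  exact congrArg Subtype.val (DFunLike.congr_fun heq a)

theorem charZero_of_padic (p : ℕ) [Fact p.Prime] (K : Type*) [Field K] [Algebra ℚ_[p] K] :
    CharZero K :=
  charZero_of_injective_algebraMap (algebraMap ℚ_[p] K).injective

/-! ### Unramified extensions of `K` -/

section extension

variable (p : ℕ) [Fact p.Prime] (K : Type*) [Field K] [Algebra ℚ_[p] K] [FiniteDimensional ℚ_[p] K]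

omit [FiniteDimensional ℚ_[p] K] in
theorem isIntegral_ringOfIntegers_iff {L : Type*} [Field L] [Algebra ℚ_[p] L] [Algebra K L]
    [IsScalarTower ℚ_[p] K L] [Algebra.IsAlgebraic ℚ_[p] L] (x : L) :
    IsIntegral (ringOfIntegers p K) x ↔ padicAbs p L x ≤ 1 := by
  have : IsScalarTower ℤ_[p] K L := IsScalarTower.of_algebraMap_eq fun a ↦ by
    change algebraMap ℚ_[p] L a = algebraMap K L (algebraMap ℚ_[p] K a)
    exact IsScalarTower.algebraMap_apply ℚ_[p] K L a
  rw [← isIntegral_iff_padicAbs_le_one]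
  exact ⟨isIntegral_trans (R := ℤ_[p]) x, fun h ↦ h.tower_top⟩

variable (E : Type*) [Field E] [Algebra K E] [FiniteDimensional K E]

theorem finite_integralClosure :
    Module.Finite (ringOfIntegers p K) (integralClosure (ringOfIntegers p K) E) := by
  have := charZero_of_padic p K
  exact IsIntegralClosure.finite (ringOfIntegers p K) K E _

theorem isDedekindDomain_integralClosure :
    IsDedekindDomain (integralClosure (ringOfIntegers p K) E) := by
  have := charZero_of_padic p K
  exact integralClosure.isDedekindDomain (ringOfIntegers p K) K E

theorem isFractionRing_integralClosure :
    IsFractionRing (integralClosure (ringOfIntegers p K) E) E :=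
  integralClosure.isFractionRing_of_finite_extension K E

/-- A primitive element whose minimal polynomial has unit different generates an unramified
extension. -/
theorem isUnramifiedExt_of_isUnit_derivative (x : integralClosure (ringOfIntegers p K) E)
    (hx : Algebra.adjoin K {(x : E)} = ⊤)
    (hu : IsUnit (aeval x (derivative (minpoly (ringOfIntegers p K) x)))) :
    IsUnramifiedExt p K E := by
  have := charZero_of_padic p K
  have := finite_integralClosure p K E
  have := isDedekindDomain_integralClosure p K E
  have := isFractionRing_integralClosure p K E
  have hmem := aeval_derivative_mem_differentIdeal (ringOfIntegers p K) K E x hx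
  have htop := Ideal.eq_top_of_isUnit_mem _ hmem hu
  have : CharZero (ringOfIntegers p K) :=
    ⟨fun a b h ↦ Nat.cast_injective (R := K) (by simpa using congrArg Subtype.val h)⟩
  exact formallyUnramified_of_differentIdeal_eq_top htop

/-- The minimal polynomial divides `X ^ N - 1`, so its derivative at `x` divides `N * x ^ (N - 1)`,
a unit because `N` is prime to `p`. -/
theorem isUnramifiedExt_of_pow_eq_one {N : ℕ} (hN : N.Coprime p) (hN0 : N ≠ 0) (x : E)
    (hx : x ^ N = 1) (hgen : Algebra.adjoin K {x} = ⊤) : IsUnramifiedExt p K E := by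
  set O := ringOfIntegers p K
  have hxi : IsIntegral O x := .of_pow (Nat.pos_of_ne_zero hN0) (hx ▸ isIntegral_one)
  let y : integralClosure O E := ⟨x, hxi⟩
  have hy : y ^ N = 1 := Subtype.ext hx
  refine isUnramifiedExt_of_isUnit_derivative p K E y hgen ?_
  have hNu : IsUnit (N : integralClosure O E) := by
    have h1 : IsUnit (N : O) := by
      rw [isUnit_iff_padicAbs_eq_one]
      exact padicAbs_natCast_eq_one p K hN
    simpa using h1.map (algebraMap O (integralClosure O E))
  have hyi : IsIntegral O y := Algebra.IsIntegral.isIntegral y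
  have hdvd : minpoly O y ∣ X ^ N - 1 :=
    minpoly.isIntegrallyClosed_dvd hyi (by simp [hy])
  obtain ⟨g, hg⟩ := hdvd
  have hd := congrArg (fun q ↦ aeval y (derivative q)) hg
  simp only [derivative_mul, map_add, map_mul, minpoly.aeval, zero_mul, add_zero] at hd
  simp only [derivative_sub, derivative_X_pow, derivative_one, sub_zero, map_mul, map_pow,
    aeval_X] at hd
  refine isUnit_of_mul_isUnit_left (y := aeval y g) ?_
  rw [← hd]
  refine IsUnit.mul (by simpa using hNu) ?_
  exact (IsUnit.of_pow_eq_one hy hN0).pow _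

section unramified

variable {E}
variable [Algebra ℚ_[p] E] [IsScalarTower ℚ_[p] K E] [Algebra.IsAlgebraic ℚ_[p] E]

omit [FiniteDimensional ℚ_[p] K] [FiniteDimensional K E] in
theorem isUnit_integralClosure_iff (x : integralClosure (ringOfIntegers p K) E) :
    IsUnit x ↔ padicAbs p E (x : E) = 1 := by
  have hle (y : integralClosure (ringOfIntegers p K) E) : padicAbs p E (y : E) ≤ 1 :=
    (isIntegral_ringOfIntegers_iff p K _).1 y.2
  constructor
  · intro h
    obtain ⟨y, hy⟩ := h.exists_right_inv
    have h1 := congrArg (fun z : integralClosure (ringOfIntegers p K) E ↦ padicAbs p E (z : E)) hy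
    simp only [Subalgebra.coe_mul, map_mul, Subalgebra.coe_one, map_one] at h1
    nlinarith [hle x, hle y, (padicAbs p E).nonneg (x : E), (padicAbs p E).nonneg (y : E)]
  · intro h
    have hx0 : (x : E) ≠ 0 := by
      intro h0
      simp [h0] at h
    refine IsUnit.of_mul_eq_one (⟨(x : E)⁻¹, (isIntegral_ringOfIntegers_iff p K _).2 ?_⟩ :
      integralClosure (ringOfIntegers p K) E) (Subtype.ext (mul_inv_cancel₀ hx0))
    rw [map_inv₀, h, inv_one]

omit [FiniteDimensional ℚ_[p] K] [FiniteDimensional K E] in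
theorem isLocalRing_integralClosure : IsLocalRing (integralClosure (ringOfIntegers p K) E) := by
  refine IsLocalRing.of_nonunits_add fun a b ha hb ↦ ?_
  have hle (y : integralClosure (ringOfIntegers p K) E) : padicAbs p E (y : E) ≤ 1 :=
    (isIntegral_ringOfIntegers_iff p K _).1 y.2
  rw [mem_nonunits_iff, isUnit_integralClosure_iff] at *
  have h := padicAbs_add_le_max p E (a : E) (b : E)
  exact (h.trans_lt (max_lt (lt_of_le_of_ne (hle a) ha) (lt_of_le_of_ne (hle b) hb))).ne

/-- An unramified extension has the same value group. -/
theorem exists_padicAbs_eq_of_isUnramifiedExt (hE : IsUnramifiedExt p K E) (x : E) (hx : x ≠ 0) :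
    ∃ y : K, y ≠ 0 ∧ padicAbs p E x = padicAbs p K y := by
  set O := ringOfIntegers p K
  set A := integralClosure O E
  have := finite_integralClosure p K E
  have := isDedekindDomain_integralClosure p K E
  have := isFractionRing_integralClosure p K E
  have : IsLocalRing A := isLocalRing_integralClosure p K
  have habs (y : K) : padicAbs p E (algebraMap K E y) = padicAbs p K y :=
    padicAbs_map p (IsScalarTower.toAlgHom ℚ_[p] K E) y
  have : IsLocalHom (algebraMap O A) := ⟨fun a ha ↦ by
    rw [isUnit_integralClosure_iff] at ha
    rw [isUnit_iff_padicAbs_eq_one, ← ha, ← habs]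
    rfl⟩
  have : Algebra.FormallyUnramified O A := hE
  -- Unramified means that a uniformiser of `K` is still a uniformiser of `E`.
  have hmax : (IsLocalRing.maximalIdeal O).map (algebraMap O A) = IsLocalRing.maximalIdeal A :=
    Algebra.FormallyUnramified.map_maximalIdeal
  obtain ⟨π, hπ⟩ := IsDiscreteValuationRing.exists_irreducible O
  rw [hπ.maximalIdeal_eq, Ideal.map_span, Set.image_singleton] at hmax
  have hπK : (π : K) ≠ 0 := fun h ↦ hπ.ne_zero (Subtype.ext h)
  have hπ0 : algebraMap O A π ≠ 0 := by
    intro h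
    have h1 : algebraMap K E (π : K) = 0 := congrArg Subtype.val h
    exact hπK ((map_eq_zero _).1 h1)
  have hfield : ¬ IsField A := by
    rw [IsLocalRing.isField_iff_maximalIdeal_eq, ← hmax, Ideal.span_singleton_eq_bot]
    exact hπ0
  have : IsDiscreteValuationRing A :=
    ((IsDiscreteValuationRing.TFAE A hfield).out 0 2).2
      (isDedekindDomain_integralClosure p K E)
  have hirr : Irreducible (algebraMap O A π) :=
    (IsDiscreteValuationRing.irreducible_iff_uniformizer _).2 hmax.symm
  have key (a : A) (ha : a ≠ 0) : ∃ y : K, y ≠ 0 ∧ padicAbs p E (a : E) = padicAbs p K y := by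
    obtain ⟨n, u, rfl⟩ := IsDiscreteValuationRing.eq_unit_mul_pow_irreducible ha hirr
    refine ⟨(π : K) ^ n, pow_ne_zero _ hπK, ?_⟩
    rw [Subalgebra.coe_mul, map_mul, (isUnit_integralClosure_iff p K _).1 u.isUnit, one_mul,
      Subalgebra.coe_pow, map_pow, map_pow, ← habs]
    rfl
  obtain ⟨a, b, hb, hab⟩ := IsFractionRing.div_surjective (A := A) x
  have hb0 : b ≠ 0 := nonZeroDivisors.ne_zero hb
  have ha0 : a ≠ 0 := by
    rintro rfl
    exact hx (by simpa using hab.symm)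
  obtain ⟨y, hy0, hy⟩ := key a ha0
  obtain ⟨z, hz0, hz⟩ := key b hb0
  refine ⟨y / z, div_ne_zero hy0 hz0, ?_⟩
  rw [← hab, map_div₀, map_div₀, ← hy, ← hz]
  rfl

end unramified

/-- An automorphism acting trivially on the residue field fixes every finite unramified
subextension. -/
theorem eq_of_isUnramifiedExt {L : Type*} [Field L] [Algebra ℚ_[p] L] [Algebra K L]
    [IsScalarTower ℚ_[p] K L] [Algebra.IsAlgebraic ℚ_[p] L] (F : IntermediateField K L)
    [FiniteDimensional K F] (hF : IsUnramifiedExt p K F) (g : L ≃ₐ[K] L)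
    (hg : ∀ x, padicAbs p L x ≤ 1 → padicAbs p L (g x - x) < 1) (x : L) (hx : x ∈ F) :
    g x = x := by
  have hle (a : integralClosure (ringOfIntegers p K) F) : padicAbs p L ((a : F) : L) ≤ 1 :=
    (isIntegral_ringOfIntegers_iff p K _).1
      (((mem_integralClosure_iff _ _).1 a.2).map (F.val.restrictScalars (ringOfIntegers p K)))
  have := finite_integralClosure p K F
  have : Algebra.FormallyUnramified (ringOfIntegers p K)
    (integralClosure (ringOfIntegers p K) F) := hF
  let φ : integralClosure (ringOfIntegers p K) F →ₐ[ringOfIntegers p K] L :=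
    (F.val.restrictScalars (ringOfIntegers p K)).comp (Subalgebra.val _)
  have hgabs (y : L) : padicAbs p L (g y) = padicAbs p L y :=
    padicAbs_map p (g.toAlgHom.restrictScalars ℚ_[p]) y
  have heq : (g.toAlgHom.restrictScalars (ringOfIntegers p K)).comp φ = φ := by
    refine algHom_eq_of_abs_sub_lt (padicAbs p L) (padicAbs_add_le_max p L) ?_ _ _ ?_ hle ?_
    · intro c
      exact (isIntegral_ringOfIntegers_iff p K _).1 isIntegral_algebraMap
    · exact fun a ↦ (hgabs _).trans_le (hle a)
    · exact fun a ↦ hg _ (hle a)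
  have hfix (a : integralClosure (ringOfIntegers p K) F) :
      g ((a : F) : L) = ((a : F) : L) := DFunLike.congr_fun heq a
  have := isFractionRing_integralClosure p K F
  obtain ⟨a, b, hb, hab⟩ := IsFractionRing.div_surjective
    (A := integralClosure (ringOfIntegers p K) F) (⟨x, hx⟩ : F)
  have hab' : ((a : F) : L) / ((b : F) : L) = x := congrArg Subtype.val hab
  rw [← hab', map_div₀, hfix, hfix]

end extension

/-! ### The maximal unramified extension -/

section maxUnramified

open IntermediateField

variable (p : ℕ) [Fact p.Prime] (K : Type*) [Field K] [Algebra ℚ_[p] K] [FiniteDimensional ℚ_[p] K]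

instance isAlgebraic_algebraicClosure : Algebra.IsAlgebraic ℚ_[p] (AlgebraicClosure K) :=
  Algebra.IsAlgebraic.trans ℚ_[p] K _

variable {p}

omit [FiniteDimensional ℚ_[p] K] in
theorem padicAbs_algEquiv {L : Type*} [Field L] [Algebra ℚ_[p] L] [Algebra K L]
    [IsScalarTower ℚ_[p] K L] [Algebra.IsAlgebraic ℚ_[p] L] (g : L ≃ₐ[K] L) (x : L) :
    padicAbs p L (g x) = padicAbs p L x :=
  padicAbs_map p (g.toAlgHom.restrictScalars ℚ_[p]) x

variable {K}

theorem finiteDimensional_adjoin_simple (x : AlgebraicClosure K) :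
    FiniteDimensional K K⟮x⟯ :=
  adjoin.finiteDimensional (Algebra.IsIntegral.isIntegral x)

theorem isUnramifiedExt_adjoin {ζ : AlgebraicClosure K}
    (hζ : ζ ∈ primeToRootsOfUnity p (AlgebraicClosure K)) : IsUnramifiedExt p K K⟮ζ⟯ := by
  have := finiteDimensional_adjoin_simple ζ
  obtain ⟨N, hN, hN0, h⟩ := hζ
  refine isUnramifiedExt_of_pow_eq_one p K _ hN hN0 (AdjoinSimple.gen K ζ) (Subtype.ext ?_) ?_
  · simpa using h
  · have := (adjoin.powerBasis
      (Algebra.IsIntegral.isIntegral ζ : IsIntegral K ζ)).adjoin_gen_eq_top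
    rwa [adjoin.powerBasis_gen] at this

theorem primeToRootsOfUnity_subset_maxUnramified :
    primeToRootsOfUnity p (AlgebraicClosure K) ⊆ maxUnramified p K := fun ζ hζ ↦
  le_iSup (fun E : {E : IntermediateField K (AlgebraicClosure K) //
    FiniteDimensional K E ∧ IsUnramifiedExt p K E} ↦ E.1)
    ⟨K⟮ζ⟯, finiteDimensional_adjoin_simple ζ, isUnramifiedExt_adjoin hζ⟩ (mem_adjoin_simple_self K ζ)

/-- The residue field of the maximal unramified extension is algebraically closed. -/
theorem exists_maxUnramified_padicAbs_sub_lt {x : AlgebraicClosure K}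
    (hx : padicAbs p (AlgebraicClosure K) x ≤ 1) :
    ∃ c ∈ maxUnramified p K, padicAbs p (AlgebraicClosure K) (x - c) < 1 := by
  obtain ⟨ζ, h0 | hζ, h⟩ := exists_primeToRootsOfUnity_sub_lt p hx
  · exact ⟨ζ, h0 ▸ zero_mem _, h⟩
  · exact ⟨ζ, primeToRootsOfUnity_subset_maxUnramified hζ, h⟩

/-- An automorphism fixing these roots of unity acts trivially on residues, since they represent
every nonzero residue; by `eq_of_isUnramifiedExt` it then fixes each finite unramified subextension.
-/
theorem mem_fixingSubgroup_maxUnramified_iff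
    (g : AlgebraicClosure K ≃ₐ[K] AlgebraicClosure K) :
    g ∈ (maxUnramified p K).fixingSubgroup ↔
      ∀ ζ ∈ primeToRootsOfUnity p (AlgebraicClosure K), g ζ = ζ := by
  constructor
  · intro h ζ hζ
    exact (mem_fixingSubgroup_iff _ _).1 h ζ (primeToRootsOfUnity_subset_maxUnramified hζ)
  · intro h
    have hres (x : AlgebraicClosure K) (hx : padicAbs p (AlgebraicClosure K) x ≤ 1) :
        padicAbs p (AlgebraicClosure K) (g x - x) < 1 := by
      obtain ⟨ζ, hζ, hlt⟩ := exists_primeToRootsOfUnity_sub_lt p hx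
      have hgζ : g ζ = ζ := by
        rcases hζ with rfl | hζ
        · exact map_zero g
        · exact h ζ hζ
      have : g x - x = g (x - ζ) + (ζ - x) := by rw [map_sub, hgζ]; ring
      rw [this]
      refine (padicAbs_add_le_max p _ _ _).trans_lt (max_lt ?_ ?_)
      · rwa [padicAbs_algEquiv]
      · rwa [AbsoluteValue.map_sub]
    have hle : maxUnramified p K ≤ fixedField (Subgroup.zpowers g) := by
      refine iSup_le fun E ↦ ?_
      have := E.2.1
      intro x hx
      rw [mem_fixedField_iff]
      intro f hf
      have hgx := eq_of_isUnramifiedExt p K E.1 E.2.2 g hres x hx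
      exact (Subgroup.zpowers_le.2 (show g ∈ MulAction.stabilizer _ x from hgx)) hf
    exact (le_iff_le _ _).1 hle (Subgroup.mem_zpowers g)

/-- The set of roots of unity of order prime to `p` is stable under the Galois group. -/
instance normal_fixingSubgroup_maxUnramified : (maxUnramified p K).fixingSubgroup.Normal := by
  refine ⟨fun n hn g ↦ ?_⟩
  rw [mem_fixingSubgroup_maxUnramified_iff] at hn ⊢
  intro ζ hζ
  have hg : g⁻¹ ζ ∈ primeToRootsOfUnity p (AlgebraicClosure K) := by
    obtain ⟨N, hN, hN0, h⟩ := hζ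
    exact ⟨N, hN, hN0, by rw [← map_pow, h, map_one]⟩
  rw [AlgEquiv.mul_apply, AlgEquiv.mul_apply, hn _ hg]
  exact g.apply_symm_apply ζ

theorem maxUnramified_le_adjoin :
    maxUnramified p K ≤ adjoin K (primeToRootsOfUnity p (AlgebraicClosure K)) := by
  have := charZero_of_padic p K
  rw [← InfiniteGalois.fixedField_fixingSubgroup
    (adjoin K (primeToRootsOfUnity p (AlgebraicClosure K))), le_iff_le]
  intro g hg
  rw [mem_fixingSubgroup_maxUnramified_iff]
  exact fun ζ hζ ↦ (mem_fixingSubgroup_iff _ _).1 hg ζ (subset_adjoin _ _ hζ)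

omit [FiniteDimensional ℚ_[p] K] in
theorem exists_adjoin_primeToRootsOfUnity_le {ζ ξ : AlgebraicClosure K}
    (hζ : ζ ∈ primeToRootsOfUnity p (AlgebraicClosure K))
    (hξ : ξ ∈ primeToRootsOfUnity p (AlgebraicClosure K)) :
    ∃ η ∈ primeToRootsOfUnity p (AlgebraicClosure K), K⟮ζ⟯ ≤ K⟮η⟯ ∧ K⟮ξ⟯ ≤ K⟮η⟯ := by
  obtain ⟨N, hN, hN0, h⟩ := hζ
  obtain ⟨M, hM, hM0, h'⟩ := hξ
  have := charZero_of_padic p K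
  have : NeZero (N * M) := ⟨mul_ne_zero hN0 hM0⟩
  have : CharZero (AlgebraicClosure K) := charZero_of_padic p _
  obtain ⟨η, hη⟩ := HasEnoughRootsOfUnity.exists_primitiveRoot (AlgebraicClosure K) (N * M)
  have key (x : AlgebraicClosure K) (hx : x ^ (N * M) = 1) : K⟮x⟯ ≤ K⟮η⟯ := by
    obtain ⟨i, -, rfl⟩ := hη.eq_pow_of_pow_eq_one hx
    exact adjoin_simple_le_iff.2 (pow_mem (mem_adjoin_simple_self K η) i)
  refine ⟨η, ⟨N * M, hN.mul_left hM, mul_ne_zero hN0 hM0, hη.pow_eq_one⟩, key ζ ?_, key ξ ?_⟩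
  · rw [pow_mul, h, one_pow]
  · rw [mul_comm, pow_mul, h', one_pow]

/-- The fields `K⟮ζ⟯` form a directed family, so their union is already a field. This reduces
questions on the value group to finite extensions. -/
theorem exists_mem_adjoin_of_mem_maxUnramified {x : AlgebraicClosure K}
    (hx : x ∈ maxUnramified p K) :
    ∃ ζ ∈ primeToRootsOfUnity p (AlgebraicClosure K), x ∈ K⟮ζ⟯ := by
  have hone : (1 : AlgebraicClosure K) ∈ primeToRootsOfUnity p (AlgebraicClosure K) :=
    ⟨1, Nat.coprime_one_left p, one_ne_zero, one_pow 1⟩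
  replace hx := maxUnramified_le_adjoin hx
  induction hx using adjoin_induction with
  | mem x hx => exact ⟨x, hx, mem_adjoin_simple_self K x⟩
  | algebraMap x => exact ⟨1, hone, _root_.algebraMap_mem _ x⟩
  | inv x _ hx =>
    obtain ⟨ζ, hζ, h⟩ := hx
    exact ⟨ζ, hζ, inv_mem h⟩
  | add x y _ _ hx hy =>
    obtain ⟨ζ, hζ, h⟩ := hx
    obtain ⟨ξ, hξ, h'⟩ := hy
    obtain ⟨η, hη, h1, h2⟩ := exists_adjoin_primeToRootsOfUnity_le hζ hξ
    exact ⟨η, hη, add_mem (h1 h) (h2 h')⟩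
  | mul x y _ _ hx hy =>
    obtain ⟨ζ, hζ, h⟩ := hx
    obtain ⟨ξ, hξ, h'⟩ := hy
    obtain ⟨η, hη, h1, h2⟩ := exists_adjoin_primeToRootsOfUnity_le hζ hξ
    exact ⟨η, hη, mul_mem (h1 h) (h2 h')⟩

/-- The maximal unramified extension has the same value group as the base field. -/
theorem exists_padicAbs_eq_of_mem_maxUnramified {x : AlgebraicClosure K}
    (hx : x ∈ maxUnramified p K) (hx0 : x ≠ 0) :
    ∃ y : K, y ≠ 0 ∧ padicAbs p (AlgebraicClosure K) x = padicAbs p K y := by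
  obtain ⟨ζ, hζ, h⟩ := exists_mem_adjoin_of_mem_maxUnramified hx
  have := finiteDimensional_adjoin_simple ζ
  have : Algebra.IsAlgebraic ℚ_[p] K⟮ζ⟯ := Algebra.IsAlgebraic.trans ℚ_[p] K _
  obtain ⟨y, hy0, hy⟩ := exists_padicAbs_eq_of_isUnramifiedExt p K (isUnramifiedExt_adjoin hζ)
    ⟨x, h⟩ (fun h0 ↦ hx0 (congrArg Subtype.val h0))
  refine ⟨y, hy0, hy ▸ ?_⟩
  exact padicAbs_map p ((K⟮ζ⟯).val.restrictScalars ℚ_[p]) (⟨x, h⟩ : K⟮ζ⟯)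

end maxUnramified

/-! ### The Frobenius group as the affine group of `ZMod p` -/

namespace FrobeniusGroup

variable (p : ℕ) [Fact p.Prime]

/-- The action of the Frobenius group `C_p ⋊ Aut(C_p)` on `C_p` by affine maps. -/
def toPerm : FrobeniusGroup p →* Equiv.Perm (Multiplicative (ZMod p)) :=
  SemidirectProduct.lift (MulAction.toPermHom _ _) (MulAut.toPerm _) fun h ↦ by
    refine MonoidHom.ext fun n ↦ Equiv.ext fun x ↦ ?_
    change h n * x = h (n * h.symm x)
    rw [map_mul, MulEquiv.apply_symm_apply]

theorem toPerm_apply (x : FrobeniusGroup p) (y : Multiplicative (ZMod p)) :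
    toPerm p x y = x.left * x.right y := rfl

theorem toPerm_injective : Function.Injective (toPerm p) := by
  intro x y h
  have h1 (z : Multiplicative (ZMod p)) : x.left * x.right z = y.left * y.right z := by
    rw [← toPerm_apply, h, toPerm_apply]
  have h2 : x.left = y.left := by simpa using h1 1
  refine SemidirectProduct.ext h2 (MulEquiv.ext fun z ↦ ?_)
  simpa [h2] using h1 z

theorem mem_range_toPerm (π : Equiv.Perm (Multiplicative (ZMod p))) (a b : ZMod p)
    (ha : a ≠ 0) (h : ∀ x : ZMod p, (π (.ofAdd x)).toAdd = a * x + b) : π ∈ (toPerm p).range := by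
  let h' : MulAut (Multiplicative (ZMod p)) :=
    AddEquiv.toMultiplicative (AddAut.mulLeft (Units.mk0 a ha))
  refine ⟨⟨.ofAdd b, h'⟩, Equiv.ext fun x ↦ ?_⟩
  rw [toPerm_apply]
  refine Multiplicative.toAdd.injective ?_
  rw [← ofAdd_toAdd x, h, add_comm]
  rfl

theorem card_eq : Nat.card (FrobeniusGroup p) = p * (p - 1) := by
  have hcyc : IsCyclic (Multiplicative (ZMod p)) := inferInstance
  rw [Nat.card_congr SemidirectProduct.equivProd, Nat.card_prod, IsCyclic.card_mulAut]
  simp [Nat.totient_prime (Fact.out : p.Prime)]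

/-- A group of affine permutations of `ZMod p` of order divisible by `p(p-1)` is the Frobenius
group. -/
theorem nonempty_mulEquiv_of_affine {G : Type*} [Group G] [Finite G] [MulAction G (ZMod p)]
    [FaithfulSMul G (ZMod p)]
    (h : ∀ (g : G) (x : ZMod p), g • x = (g • (1 : ZMod p) - g • (0 : ZMod p)) * x + g • (0 : ZMod p))
    (hcard : p * (p - 1) ∣ Nat.card G) : Nonempty (G ≃* FrobeniusGroup p) := by
  let c : Equiv.Perm (ZMod p) →* Equiv.Perm (Multiplicative (ZMod p)) :=
    (Equiv.permCongrHom Multiplicative.ofAdd).toMonoidHom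
  let θ : G →* Equiv.Perm (Multiplicative (ZMod p)) := c.comp (MulAction.toPermHom G (ZMod p))
  have hθ : Function.Injective θ := by
    intro g g' hg
    refine MulAction.toPerm_injective (β := ZMod p) ?_
    exact (Equiv.permCongrHom Multiplicative.ofAdd).injective hg
  have hmem (g : G) : θ g ∈ (toPerm p).range := by
    refine mem_range_toPerm p _ (g • (1 : ZMod p) - g • (0 : ZMod p)) (g • (0 : ZMod p)) ?_ (h g)
    rw [sub_ne_zero]
    exact fun h' ↦ one_ne_zero (MulAction.injective g h')
  let ψ : G →* (toPerm p).range := θ.codRestrict _ hmem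
  have hψ : Function.Injective ψ := fun g g' h ↦ hθ (congrArg Subtype.val h)
  let ε := MonoidHom.ofInjective (toPerm_injective p)
  -- `G` embeds in a group of order `p * (p - 1)`, and divisibility of its order makes the embedding
  -- bijective.
  have hε : Function.Injective (ε.symm.toMonoidHom.comp ψ) := ε.symm.injective.comp hψ
  have hfin : Finite (FrobeniusGroup p) := Finite.of_equiv _ SemidirectProduct.equivProd.symm
  refine ⟨MulEquiv.ofBijective (ε.symm.toMonoidHom.comp ψ)
    ((Nat.bijective_iff_injective_and_card _).2 ⟨hε, le_antisymm ?_ ?_⟩)⟩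
  · exact Nat.card_le_card_of_injective _ hε
  · rw [card_eq]
    exact Nat.le_of_dvd Nat.card_pos hcard

end FrobeniusGroup

/-! ### Isometric actions on `p` points of a valued field -/

section affine

variable {p : ℕ} [Fact p.Prime]

/-- An element of prime order `p` acting nontrivially on a set with `p` elements is a `p`-cycle. -/
theorem exists_equiv_zmod {G ι : Type*} [Group G] [MulAction G ι] [FaithfulSMul G ι] [Finite ι]
    (hι : Nat.card ι = p) {σ : G} (hσ : orderOf σ = p) :
    ∃ e : ZMod p ≃ ι, ∀ (m : ℕ) (k : ZMod p), σ ^ m • e k = e (k + m) := by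
  have hp : p.Prime := Fact.out
  have hσ1 : σ ≠ 1 := by
    rintro rfl
    exact hp.one_lt.ne (orderOf_one.symm.trans hσ)
  obtain ⟨i, hi⟩ : ∃ i : ι, σ • i ≠ i := by
    by_contra! hcon
    exact hσ1 (eq_of_smul_eq_smul fun i : ι ↦ (hcon i).trans (one_smul G i).symm)
  have hper : Function.minimalPeriod (σ • ·) i = p := by
    have hd : Function.minimalPeriod (σ • ·) i ∣ p := by
      rw [← MulAction.period_eq_minimalPeriod, ← hσ]
      exact MulAction.period_dvd_orderOf σ i
    refine (hp.eq_one_or_self_of_dvd _ hd).resolve_left fun h1 ↦ hi ?_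
    exact Function.minimalPeriod_eq_one_iff_isFixedPt.1 h1
  have hit (m : ℕ) : (σ • ·)^[m] i = σ ^ m • i := by
    rw [smul_iterate]
  let e (k : ZMod p) : ι := σ ^ k.val • i
  have hinj : Function.Injective e := by
    intro k l hkl
    refine ZMod.val_injective p (Function.iterate_injOn_Iio_minimalPeriod (f := (σ • ·)) (x := i)
      ?_ ?_ ?_)
    · rw [hper]; exact ZMod.val_lt k
    · rw [hper]; exact ZMod.val_lt l
    · simpa only [hit] using hkl
  have hbij : Function.Bijective e :=
    (Nat.bijective_iff_injective_and_card e).2 ⟨hinj, by rw [hι, Nat.card_zmod]⟩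
  refine ⟨Equiv.ofBijective e hbij, fun m k ↦ ?_⟩
  change σ ^ m • σ ^ k.val • i = σ ^ (k + m).val • i
  rw [smul_smul, ← pow_add, ZMod.val_add, ZMod.val_natCast, ← pow_mod_orderOf, hσ,
    ← Nat.add_mod_mod, Nat.add_comm k.val]
  congr 2
  simp [Nat.add_mod]

variable {G M : Type*} [Group G] [Field M] [MulSemiringAction G M] (v : Valuation M NNReal)
  [MulAction G (ZMod p)] {α : ZMod p → M}

/-- If a `p`-cycle acts by isometries on `p` points, all distances are equal. -/
theorem valuation_sub_eq (hinv : ∀ (g : G) x, v (g • x) = v x)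
    (hα : ∀ (g : G) i, g • α i = α (g • i)) {σ : G}
    (hσ : ∀ (m : ℕ) (k : ZMod p), σ ^ m • k = k + m) {k l : ZMod p} (hkl : k ≠ l) :
    v (α k - α l) = v (α 1 - α 0) := by
  have hshift (m : ℕ) (k l : ZMod p) : v (α (k + m) - α (l + m)) = v (α k - α l) := by
    rw [← hσ, ← hσ, ← hα, ← hα, ← smul_sub, hinv]
  -- Telescoping in steps of length `m`: each step has the same size, and the ultrametric inequality
  -- bounds the sum.
  have hmul (n m : ℕ) : v (α (n * m : ℕ) - α 0) ≤ v (α m - α 0) := by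
    induction n with
    | zero => simp
    | succ n ih =>
      have h1 : α ((n + 1) * m : ℕ) - α 0 =
          (α ((n * m : ℕ) + (m : ZMod p)) - α (0 + m)) + (α m - α 0) := by
        rw [zero_add]
        push_cast
        ring_nf
      rw [h1]
      refine (v.map_add _ _).trans (max_le ?_ le_rfl)
      rw [hshift]
      exact ih
  have key (m : ZMod p) (hm : m ≠ 0) : v (α m - α 0) = v (α 1 - α 0) := by
    refine le_antisymm ?_ ?_
    · simpa using hmul m.val 1
    -- Since `m⁻¹ * m = 1` in `ZMod p`, steps of length `m` also reach `1` from `0`.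
    · have := hmul (m⁻¹).val m.val
      push_cast at this
      simpa [hm] using this
  have h1 := hshift l.val (k - l) 0
  rw [ZMod.natCast_zmod_val, sub_add_cancel, zero_add] at h1
  rw [h1]
  exact key _ (sub_ne_zero.2 hkl)

/-- If moreover the group acts trivially on a residue field of characteristic `p`, it acts by affine
maps. -/
theorem smul_eq_affine (hp : v (p : M) < 1) (hinj : Function.Injective α)
    (hinv : ∀ (g : G) x, v (g • x) = v x)
    (hres : ∀ (g : G) x, v x ≤ 1 → v (g • x - x) < 1)
    (hα : ∀ (g : G) i, g • α i = α (g • i)) {σ : G}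
    (hσ : ∀ (m : ℕ) (k : ZMod p), σ ^ m • k = k + m) (g : G) (x : ZMod p) :
    g • x = (g • (1 : ZMod p) - g • (0 : ZMod p)) * x + g • (0 : ZMod p) := by
  have hd {k l : ZMod p} (hkl : k ≠ l) := valuation_sub_eq v hinv hα hσ hkl
  have h10 : α 1 - α 0 ≠ 0 := sub_ne_zero.2 (hinj.ne one_ne_zero)
  have hv10 : v (α 1 - α 0) ≠ 0 := v.ne_zero_iff.2 h10
  have hle (k l : ZMod p) : v ((α k - α l) / (α 1 - α 0)) ≤ 1 := by
    rcases eq_or_ne k l with rfl | hkl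
    · simp
    · rw [map_div₀, hd hkl, div_self hv10]
  let O := v.valuationSubring
  let res := IsLocalRing.residue O
  have hres0 (a : O) : res a = 0 ↔ v (a : M) < 1 := by
    rw [IsLocalRing.residue_eq_zero_iff]
    exact v.mem_maximalIdeal_iff
  let t (k l : ZMod p) : O := ⟨(α k - α l) / (α 1 - α 0), hle k l⟩
  -- The residue coordinate of a point, normalised by `s 0 = 0` and `s 1 = 1`. Equal distances make
  -- it injective.
  let s (k : ZMod p) := res (t k 0)
  have hts (k l : ZMod p) : res (t k l) = s k - s l := by
    rw [← map_sub]
    congr 1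
    refine Subtype.ext ?_
    change (α k - α l) / (α 1 - α 0) = (α k - α 0) / (α 1 - α 0) - (α l - α 0) / (α 1 - α 0)
    ring
  have hs0 : s 0 = 0 := by
    have : t 0 0 = 0 := Subtype.ext (by simp [t])
    simp [s, this]
  have hs1 : s 1 = 1 := by
    have : t 1 0 = 1 := Subtype.ext (div_self h10)
    simp [s, this]
  -- Applying `g` to the ratio `t k 0` does not change its residue, so `g` is affine in the
  -- coordinate `s`.
  have hact (g : G) (k : ZMod p) : s (g • k) = (s (g • 1) - s (g • 0)) * s k + s (g • 0) := by
    rw [← sub_eq_iff_eq_add, ← hts, ← hts, ← map_mul, ← sub_eq_zero, ← map_sub, hres0]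
    have h2 : α (g • 1) - α (g • 0) ≠ 0 :=
      sub_ne_zero.2 (hinj.ne ((MulAction.injective g).ne one_ne_zero))
    have h1 : ((t (g • k) (g • 0) - t (g • 1) (g • 0) * t k 0 : O) : M) =
        (t (g • 1) (g • 0) : M) * (g • (t k 0 : M) - t k 0) := by
      change (α (g • k) - α (g • 0)) / (α 1 - α 0) -
        (α (g • 1) - α (g • 0)) / (α 1 - α 0) * ((α k - α 0) / (α 1 - α 0)) =
        (α (g • 1) - α (g • 0)) / (α 1 - α 0) * (g • ((α k - α 0) / (α 1 - α 0)) -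
          ((α k - α 0) / (α 1 - α 0)))
      rw [div_eq_mul_inv (α k - α 0), smul_mul', smul_inv'', smul_sub, smul_sub, hα, hα, hα]
      field_simp
    rw [h1, map_mul]
    exact (mul_le_of_le_one_left' (hle _ _)).trans_lt (hres g _ (hle _ _))
  have hsinj : Function.Injective s := by
    intro k l hkl
    by_contra hne
    have h1 : res (t k l) = 0 := by rw [hts, hkl, sub_self]
    rw [hres0] at h1
    change v ((α k - α l) / (α 1 - α 0)) < 1 at h1
    rw [map_div₀, hd hne, div_self hv10] at h1
    exact lt_irrefl _ h1
  have hpk : (p : IsLocalRing.ResidueField O) = 0 := by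
    rw [← map_natCast res, hres0]
    simpa using hp
  have : CharP (IsLocalRing.ResidueField O) p := (CharP.charP_iff_prime_eq_zero Fact.out).2 hpk
  obtain ⟨c, hc⟩ : ∃ c, ∀ k, s (k + 1) = c * s k + 1 := by
    refine ⟨s (σ • 1) - s (σ • 0), fun k ↦ ?_⟩
    have hσ1 (k : ZMod p) : σ • k = k + 1 := by simpa using hσ 1 k
    have := hact σ k
    rw [hσ1 k, hσ1 0, zero_add, hs1] at this
    rw [this, hσ1 0, zero_add, hs1]
  have hgeom (m : ℕ) : (c - 1) * s m = c ^ m - 1 := by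
    induction m with
    | zero => simp [hs0]
    | succ m ih =>
      rw [Nat.cast_succ, hc, mul_add, mul_left_comm, ih]
      ring
  -- The cycle closes up after `p` steps, so `c ^ p = 1`, and in characteristic `p` this forces `c =
  -- 1`. Hence `s` is the canonical embedding of `ZMod p`.
  have hc1 : c = 1 := by
    have := hgeom p
    rw [CharP.cast_eq_zero, hs0, mul_zero] at this
    have h2 : (c - 1) ^ p = 0 := by rw [sub_pow_char, one_pow, this]
    exact sub_eq_zero.1 (pow_eq_zero_iff (Fact.out : p.Prime).ne_zero |>.1 h2)
  have hsm (m : ℕ) : s m = m := by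
    induction m with
    | zero => simp [hs0]
    | succ m ih => rw [Nat.cast_succ, hc, hc1, ih, one_mul, Nat.cast_succ]
  have hs (k : ZMod p) : s k = ZMod.castHom dvd_rfl (IsLocalRing.ResidueField O) k := by
    have := hsm k.val
    rwa [← map_natCast (ZMod.castHom dvd_rfl (IsLocalRing.ResidueField O)),
      ZMod.natCast_zmod_val] at this
  have := hact g x
  simp only [hs, ← map_sub, ← map_mul, ← map_add] at this
  exact (ZMod.castHom dvd_rfl (IsLocalRing.ResidueField O)).injective this

omit [MulAction G (ZMod p)] in
/-- Criterion for a group acting on `p` points of a valued field to be the Frobenius group. -/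
theorem nonempty_mulEquiv_frobeniusGroup_of_valuation {ι : Type*} [Finite G] [Fintype ι]
    [DecidableEq ι] [MulAction G ι] [FaithfulSMul G ι] (hι : Nat.card ι = p) (hG : p ∣ Nat.card G)
    (β : ι → M) (hinj : Function.Injective β) (hβ : ∀ (g : G) i, g • β i = β (g • i))
    (hp : v (p : M) < 1) (hinv : ∀ (g : G) x, v (g • x) = v x)
    (hres : ∀ (g : G) x, v x ≤ 1 → v (g • x - x) < 1)
    {ϖ : NNReal} (hϖ0 : 0 < ϖ) (hϖ1 : ϖ < 1)
    (hfix : ∀ x, x ≠ 0 → (∀ g : G, g • x = x) → ∃ n : ℤ, v x = ϖ ^ n)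
    {d : ℤ} (hd : ∏ i, ∏ j ∈ Finset.univ.erase i, v (β i - β j) = ϖ ^ d)
    (hgcd : Int.gcd d ((p : ℤ) - 1) = 1) : Nonempty (G ≃* FrobeniusGroup p) := by
  have hpp : p.Prime := Fact.out
  obtain ⟨σ, hσo⟩ := exists_prime_orderOf_dvd_card' p hG
  obtain ⟨e, he⟩ := exists_equiv_zmod hι hσo
  let _ : MulAction G (ZMod p) := e.mulAction G
  have hsmul (g : G) (k : ZMod p) : e (g • k) = g • e k := e.apply_symm_apply _
  have hfaith : FaithfulSMul G (ZMod p) := ⟨fun {g g'} h ↦ eq_of_smul_eq_smul fun i : ι ↦ by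
    have := congrArg e (h (e.symm i))
    rwa [hsmul, hsmul, e.apply_symm_apply] at this⟩
  have hσ (m : ℕ) (k : ZMod p) : σ ^ m • k = k + m := e.injective (by rw [hsmul, he])
  have hα (g : G) (k : ZMod p) : g • (β ∘ e) k = (β ∘ e) (g • k) := by
    simp [hβ, hsmul]
  refine FrobeniusGroup.nonempty_mulEquiv_of_affine p
    (smul_eq_affine v hp (hinj.comp e.injective) hinv hres hα hσ) ?_
  set r := v ((β ∘ e) 1 - (β ∘ e) 0) with hr
  have hdist {i j : ι} (hij : i ≠ j) : v (β i - β j) = r := by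
    have := valuation_sub_eq v hinv hα hσ (e.symm.injective.ne hij)
    simpa [hr] using this
  have hprod : r ^ (p * (p - 1)) = ϖ ^ d := by
    rw [← hd, Finset.prod_congr rfl fun i _ ↦ Finset.prod_congr rfl fun j hj ↦
      hdist (Finset.ne_of_mem_erase hj).symm]
    simp only [Finset.prod_const, Finset.card_erase_of_mem (Finset.mem_univ _), Finset.card_univ,
      ← Nat.card_eq_fintype_card, hι]
    rw [← pow_mul, mul_comm]
  have := Fintype.ofFinite G
  let x := (β ∘ e) 1 - (β ∘ e) 0
  have hx : x ≠ 0 := sub_ne_zero.2 ((hinj.comp e.injective).ne one_ne_zero)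
  -- The norm of a root difference is fixed by `G`, so `hfix` makes `r ^ |G|` an integral power of
  -- `ϖ`.
  obtain ⟨n, hn⟩ := hfix (∏ g : G, g • x)
    (Finset.prod_ne_zero_iff.2 fun g _ ↦ (smul_ne_zero_iff_ne g).2 hx)
    fun g ↦ by
      rw [Finset.smul_prod']
      simp only [smul_smul]
      exact Fintype.prod_equiv (Equiv.mulLeft g) _ _ fun _ ↦ rfl
  rw [map_prod, Finset.prod_congr rfl fun g _ ↦ hinv g x, Finset.prod_const, Finset.card_univ,
    ← Nat.card_eq_fintype_card] at hn
  -- Both sides are the exponent of `ϖ` in `r ^ (p * (p - 1) * |G|)`.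
  have hcomb : d * Nat.card G = n * (p * (p - 1) : ℕ) := by
    refine zpow_right_injective₀ hϖ0 hϖ1.ne ?_
    simp only [zpow_mul, ← hn, ← hprod, zpow_natCast]
    rw [← pow_mul, ← pow_mul, mul_comm]
  have h1 : ((p : ℤ) - 1) ∣ Nat.card G := by
    refine IsCoprime.dvd_of_dvd_mul_left (y := d) ?_ ?_
    · exact (Int.isCoprime_iff_gcd_eq_one.2 hgcd).symm
    · rw [hcomb]
      push_cast [Nat.cast_sub hpp.one_lt.le]
      exact ⟨n * p, by ring⟩
  have h2 : p - 1 ∣ Nat.card G := by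
    have : ((p - 1 : ℕ) : ℤ) = (p : ℤ) - 1 := by push_cast [Nat.cast_sub hpp.one_lt.le]; ring
    rw [← this] at h1
    exact Int.natCast_dvd_natCast.1 h1
  refine Nat.Coprime.mul_dvd_of_dvd_of_dvd ?_ hG h2
  rw [hpp.coprime_iff_not_dvd]
  exact Nat.not_dvd_of_pos_of_lt (Nat.sub_pos_of_lt hpp.one_lt) (Nat.sub_lt hpp.pos one_pos)

end affine

/-! ### Discriminants and root differences -/

section discriminant

/-- The discriminant of a monic polynomial commutes with base change. -/
theorem discr_map_of_monic {R S : Type*} [CommRing R] [CommRing S] [Nontrivial S] (φ : R →+* S)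
    {f : R[X]} (hf : f.Monic) (hdeg : 0 < f.natDegree) : (f.map φ).discr = φ f.discr := by
  have h1 := resultant_deriv (f := f.map φ)
    (natDegree_pos_iff_degree_pos.1 (by rwa [hf.natDegree_map]))
  have h2 := congrArg φ (resultant_deriv (natDegree_pos_iff_degree_pos.1 hdeg))
  rw [hf.natDegree_map, derivative_map, resultant_map_map, h2, (hf.map φ).leadingCoeff,
    hf.leadingCoeff] at h1
  simp only [mul_one, map_mul, map_pow, map_neg, map_one] at h1
  exact (((isUnit_one.neg.pow _).mul_right_inj).1 h1).symm

theorem eval_derivative_prod_X_sub_C {ι R : Type*} [Fintype ι] [DecidableEq ι] [CommRing R]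
    (β : ι → R) (i : ι) : eval (β i) (derivative (∏ j, (X - C (β j)))) =
      ∏ j ∈ Finset.univ.erase i, (β i - β j) := by
  rw [derivative_prod_finset, eval_finsetSum, Finset.sum_eq_single i]
  · simp [eval_prod]
  · intro j _ hj
    rw [eval_mul, eval_prod, Finset.prod_eq_zero (i := i), zero_mul]
    · exact Finset.mem_erase.2 ⟨hj.symm, Finset.mem_univ i⟩
    · simp
  · simp

/-- Up to a sign, which the valuation ignores, the discriminant is the resultant with the
derivative, that is, the product of the values of the derivative at the roots. -/
theorem valuation_discr {ι L : Type*} [Fintype ι] [DecidableEq ι] [Nonempty ι] [Field L]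
    (v : Valuation L NNReal) (β : ι → L) {f : L[X]} (hf : f = ∏ i, (X - C (β i))) :
    v f.discr = ∏ i, ∏ j ∈ Finset.univ.erase i, v (β i - β j) := by
  have hmon : f.Monic := hf ▸ monic_prod_X_sub_C β _
  have hspl : f.Splits := hf ▸ Splits.prod fun i _ ↦ Splits.X_sub_C _
  have hroots : f.roots = Finset.univ.val.map β := by
    rw [hf, Finset.prod, ← roots_multiset_prod_X_sub_C (Finset.univ.val.map β), Multiset.map_map]
    rfl
  have hdeg : 0 < f.natDegree := by
    rw [hf, natDegree_prod_of_monic _ _ fun i _ ↦ monic_X_sub_C _]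
    simp [Fintype.card_pos]
  have h1 := resultant_deriv (natDegree_pos_iff_degree_pos.1 hdeg)
  rw [resultant_eq_prod_eval _ _ _ (natDegree_derivative_le f) hspl, hmon.leadingCoeff, one_pow,
    one_mul, mul_one, hroots, Multiset.map_map] at h1
  have h2 := congrArg v h1
  rw [map_mul, map_pow, Valuation.map_neg, map_one, one_pow, one_mul] at h2
  rw [← h2, map_multiset_prod, Multiset.map_map]
  change ∏ i, v (eval (β i) (derivative f)) = _
  refine Finset.prod_congr rfl fun i _ ↦ ?_
  rw [← map_prod, hf, eval_derivative_prod_X_sub_C]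

theorem map_eq_prod_rootSet {F L : Type*} [Field F] [Field L] [Algebra F L] {f : F[X]}
    (hmon : f.Monic) (hsep : f.Separable) (hspl : (f.map (algebraMap F L)).Splits) :
    f.map (algebraMap F L) = ∏ i : f.rootSet L, (X - C (i : L)) := by
  classical
  rw [← Finset.prod_subtype (f.map (algebraMap F L)).roots.toFinset
    (p := (· ∈ f.rootSet L)) (fun x ↦ by simp [rootSet_def, aroots_def]) fun x ↦ X - C x,
    Finset.prod, Multiset.toFinset_val, (nodup_roots hsep.map).dedup]
  exact hspl.eq_prod_roots_of_monic (hmon.map _)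

/-- The terms at `(i, j)` and `(j, i)` cancel modulo 2. -/
theorem even_sum_erase {ι : Type*} [Fintype ι] [DecidableEq ι] (n : ι → ι → ℤ)
    (hn : ∀ i j, i ≠ j → n i j = n j i) : Even (∑ i, ∑ j ∈ Finset.univ.erase i, n i j) := by
  rw [← ZMod.intCast_eq_zero_iff_even, Finset.sum_sigma']
  push_cast
  refine Finset.sum_involution (fun x _ ↦ ⟨x.2, x.1⟩) ?_ ?_ ?_ ?_
  · intro x hx
    rw [hn x.2 x.1 (Finset.ne_of_mem_erase (Finset.mem_sigma.1 hx).2)]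
    exact CharTwo.add_self_eq_zero _
  · rintro ⟨i, j⟩ hx _ heq
    simp only [Finset.mem_sigma, Finset.mem_erase] at hx
    exact hx.2.1 (congrArg Sigma.fst heq)
  · rintro ⟨i, j⟩ hx
    simpa [eq_comm] using hx
  · intro x _
    rfl

end discriminant

theorem prod_zpow_eq_zpow_sum {ι G : Type*} [CommGroupWithZero G] {a : G} (ha : a ≠ 0)
    (s : Finset ι) (n : ι → ℤ) : ∏ i ∈ s, a ^ n i = a ^ ∑ i ∈ s, n i := by
  classical
  induction s using Finset.induction_on with
  | empty => simp
  | insert i s hi ih => rw [Finset.prod_insert hi, Finset.sum_insert hi, ih, zpow_add₀ ha]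

/-! ### Irreducibility and Galois group over the maximal unramified extension -/

section main

open IntermediateField

variable (p : ℕ) [Fact p.Prime] (K : Type*) [Field K] [Algebra ℚ_[p] K] [FiniteDimensional ℚ_[p] K]

/-- The multiplicative valuation attached to `padicAbs`. -/
noncomputable def padicValuation (L : Type*) [Field L] [Algebra ℚ_[p] L]
    [Algebra.IsAlgebraic ℚ_[p] L] : Valuation L NNReal where
  toFun x := ⟨padicAbs p L x, (padicAbs p L).nonneg x⟩
  map_zero' := NNReal.eq (map_zero _)
  map_one' := NNReal.eq (map_one _)
  map_mul' x y := NNReal.eq (map_mul _ x y)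
  map_add_le_max' := padicAbs_add_le_max p L

variable {p K}

theorem coe_padicValuation {L : Type*} [Field L] [Algebra ℚ_[p] L]
    [Algebra.IsAlgebraic ℚ_[p] L] (x : L) : (padicValuation p L x : ℝ) = padicAbs p L x := rfl

variable (p K) in
theorem exists_uniformizer_padicValuation : ∃ ϖ : NNReal, 0 < ϖ ∧ ϖ < 1 ∧
    (∀ x : K, x ≠ 0 → padicValuation p (AlgebraicClosure K) (algebraMap K _ x) =
      ϖ ^ normalizedVal p K x) ∧
    ∀ x ∈ maxUnramified p K, x ≠ 0 →
      ∃ n : ℤ, padicValuation p (AlgebraicClosure K) x = ϖ ^ n := by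
  obtain ⟨π, h1, h0, hπ⟩ := exists_uniformizer p K
  refine ⟨padicValuation p K π, h0, h1, fun x hx ↦ NNReal.eq ?_,
    fun x hx hx0 ↦ ?_⟩
  · rw [NNReal.coe_zpow, coe_padicValuation, coe_padicValuation, ← hπ x hx]
    exact padicAbs_map p (IsScalarTower.toAlgHom ℚ_[p] K (AlgebraicClosure K)) x
  · obtain ⟨y, hy0, hy⟩ := exists_padicAbs_eq_of_mem_maxUnramified hx hx0
    refine ⟨normalizedVal p K y, NNReal.eq ?_⟩
    rw [NNReal.coe_zpow, coe_padicValuation, coe_padicValuation, ← hπ y hy0, ← hy]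

/-- An irreducible polynomial of prime degree stays irreducible over the fixed field of a normal
subgroup or splits completely there. -/
theorem irreducible_map_or_rootSet_subset {k Ω : Type*} [Field k] [Field Ω] [Algebra k Ω]
    [IsGalois k Ω] {f : k[X]} (hf : Irreducible f) (hmon : f.Monic) (hsep : f.Separable)
    (hspl : (f.map (algebraMap k Ω)).Splits) (hprime : f.natDegree.Prime)
    (F : IntermediateField k Ω) [F.fixingSubgroup.Normal] :
    Irreducible (f.map (algebraMap k F)) ∨ f.rootSet Ω ⊆ F := by
  have : Fact (f.map (algebraMap k Ω)).Splits := ⟨hspl⟩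
  let _ : MulAction (Ω ≃ₐ[k] Ω) (f.rootSet Ω) := MulAction.compHom _ (Gal.restrict f Ω)
  have hsmul (g : Ω ≃ₐ[k] Ω) (x : f.rootSet Ω) : ((g • x : f.rootSet Ω) : Ω) = g x :=
    Gal.restrict_smul g x
  have hcard : Nat.card (f.rootSet Ω) = f.natDegree := by
    rw [Nat.card_eq_fintype_card, card_rootSet_eq_natDegree hsep hspl]
  have : MulAction.IsPretransitive (Ω ≃ₐ[k] Ω) (f.rootSet Ω) := by
    have := Gal.galAction_isPretransitive f Ω hf
    refine ⟨fun x y ↦ ?_⟩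
    obtain ⟨g, hg⟩ := MulAction.exists_smul_eq f.Gal x y
    obtain ⟨g', rfl⟩ := Gal.restrict_surjective f Ω g
    exact ⟨g', hg⟩
  have : MulAction.IsPreprimitive (Ω ≃ₐ[k] Ω) (f.rootSet Ω) :=
    MulAction.IsPreprimitive.of_prime_card (hcard ▸ hprime)
  by_cases hfix : MulAction.fixedPoints F.fixingSubgroup (f.rootSet Ω) = Set.univ
  · right
    intro x hx
    rw [← InfiniteGalois.fixedField_fixingSubgroup F]
    refine (mem_fixedField_iff _ _).2 fun g hg ↦ ?_
    have h1 : (⟨x, hx⟩ : f.rootSet Ω) ∈ MulAction.fixedPoints F.fixingSubgroup (f.rootSet Ω) :=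
      hfix ▸ Set.mem_univ _
    exact (hsmul g ⟨x, hx⟩).symm.trans (congrArg Subtype.val (h1 ⟨g, hg⟩))
  · left
    -- The full Galois group is primitive on a prime number of roots, so a normal subgroup acting
    -- nontrivially is transitive.
    have htrans := MulAction.IsQuasiPreprimitive.isPretransitive_of_normal hfix
    have : Nonempty (f.rootSet Ω) :=
      (Nat.card_pos_iff.1 (hcard ▸ hprime.pos)).1
    obtain ⟨a⟩ := this
    have hint : IsIntegral F (a : Ω) :=
      (Algebra.IsIntegral.isIntegral (R := k) (a : Ω)).tower_top
    have hdvd : minpoly F (a : Ω) ∣ f.map (algebraMap k F) := by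
      refine minpoly.dvd _ _ ?_
      rw [aeval_map_algebraMap]
      exact (mem_rootSet.1 a.2).2
    -- By transitivity all roots of `f` are conjugate over `F`, so the minimal polynomial of one of
    -- them has full degree.
    have hsub : f.rootSet Ω ⊆ (minpoly F (a : Ω)).rootSet Ω := by
      intro b hb
      obtain ⟨g, hg⟩ := MulAction.exists_smul_eq F.fixingSubgroup a (⟨b, hb⟩ : f.rootSet Ω)
      have hgb : (g : Ω ≃ₐ[k] Ω) a = b := (hsmul g a).symm.trans (congrArg Subtype.val hg)
      have hmin := minpoly.algEquiv_eq (fixingSubgroupEquiv F g) (a : Ω)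
      rw [show fixingSubgroupEquiv F g (a : Ω) = b from hgb] at hmin
      rw [mem_rootSet]
      exact ⟨minpoly.ne_zero hint, hmin ▸ minpoly.aeval F b⟩
    have hle : f.natDegree ≤ (minpoly F (a : Ω)).natDegree := by
      rw [← hcard, Nat.card_coe_set_eq]
      exact (Set.ncard_le_ncard hsub (Set.toFinite _)).trans (ncard_rootSet_le _ _)
    have := eq_of_monic_of_dvd_of_natDegree_le (minpoly.monic hint) (hmon.map _) hdvd
      (by rwa [hmon.natDegree_map])
    rw [this]
    exact minpoly.irreducible hint

/-- Root differences lying in `maxUnramified p K` have integral exponents, symmetric in the two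
roots, and the discriminant collects each of them twice. -/
theorem even_normalizedVal_discr_of_rootSet_subset {f : K[X]} (hmon : f.Monic)
    (hsep : f.Separable) (hdeg : 0 < f.natDegree)
    (h : f.rootSet (AlgebraicClosure K) ⊆ maxUnramified p K) :
    Even (normalizedVal p K f.discr) := by
  classical
  obtain ⟨ϖ, hϖ0, hϖ1, hK, hF⟩ := exists_uniformizer_padicValuation p K
  have hspl : (f.map (algebraMap K (AlgebraicClosure K))).Splits := IsAlgClosed.splits _
  have : Nonempty (f.rootSet (AlgebraicClosure K)) := by
    rw [← Fintype.card_pos_iff, card_rootSet_eq_natDegree hsep hspl]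
    exact hdeg
  have hval := valuation_discr (padicValuation p (AlgebraicClosure K))
    (Subtype.val : f.rootSet (AlgebraicClosure K) → _) (map_eq_prod_rootSet hmon hsep hspl)
  rw [discr_map_of_monic _ hmon hdeg] at hval
  have hex (i j : f.rootSet (AlgebraicClosure K)) : ∃ n : ℤ, i ≠ j →
      padicValuation p (AlgebraicClosure K) ((i : AlgebraicClosure K) - j) = ϖ ^ n := by
    by_cases hij : i = j
    · exact ⟨0, fun h ↦ (h hij).elim⟩
    · obtain ⟨n, hn⟩ := hF _ (sub_mem (h i.2) (h j.2)) (sub_ne_zero.2 (Subtype.coe_ne_coe.2 hij))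
      exact ⟨n, fun _ ↦ hn⟩
  have hinj := zpow_right_injective₀ hϖ0 hϖ1.ne
  choose n hn using hex
  have hd0 : f.discr ≠ 0 := by
    intro h0
    rw [h0, map_zero, map_zero] at hval
    refine Finset.prod_ne_zero_iff.2 (fun i _ ↦ Finset.prod_ne_zero_iff.2 fun j hj ↦ ?_) hval.symm
    rw [hn i j (Finset.ne_of_mem_erase hj).symm]
    exact zpow_ne_zero _ hϖ0.ne'
  rw [hK _ hd0, Finset.prod_congr rfl fun i _ ↦ Finset.prod_congr rfl fun j hj ↦
    hn i j (Finset.ne_of_mem_erase hj).symm] at hval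
  simp only [prod_zpow_eq_zpow_sum hϖ0.ne'] at hval
  rw [hinj hval]
  refine even_sum_erase n fun i j hij ↦ hinj ?_
  change ϖ ^ n i j = ϖ ^ n j i
  rw [← hn i j hij, ← hn j i hij.symm, Valuation.map_sub_swap]

/-- The Galois group over the maximal unramified extension of a polynomial of degree `p` which is
irreducible there. -/
theorem nonempty_gal_mulEquiv_frobeniusGroup {f : K[X]} (hmon : f.Monic) (hdeg : f.natDegree = p)
    (hirr : Irreducible (f.map (algebraMap K (maxUnramified p K))))
    (hd0 : f.discr ≠ 0)
    (hgcd : Int.gcd (normalizedVal p K f.discr) ((p : ℤ) - 1) = 1) :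
    Nonempty ((f.map (algebraMap K (maxUnramified p K))).Gal ≃* FrobeniusGroup p) := by
  classical
  have := charZero_of_padic p K
  obtain ⟨ϖ, hϖ0, hϖ1, hK, hF⟩ := exists_uniformizer_padicValuation p K
  set F := maxUnramified p K
  set q := f.map (algebraMap K F) with hq
  have hqmon : q.Monic := hmon.map _
  have hqdeg : q.natDegree = p := by rw [hq, hmon.natDegree_map, hdeg]
  have hpp : p.Prime := Fact.out
  have hqsep : q.Separable := hirr.separable
  let Ω := AlgebraicClosure K
  have hspl : Fact (q.map (algebraMap F Ω)).Splits := ⟨IsAlgClosed.splits _⟩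
  let M := q.SplittingField
  have hMspl : (q.map (algebraMap F M)).Splits := SplittingField.splits q
  let v : Valuation M NNReal := (padicValuation p Ω).comap (algebraMap M Ω)
  have hcomm (g : q.Gal) : ∃ g' : Ω ≃ₐ[F] Ω, ∀ x : M, algebraMap M Ω (g • x) =
      g' (algebraMap M Ω x) := by
    obtain ⟨g', rfl⟩ := Gal.restrict_surjective q Ω g
    exact ⟨g', fun x ↦ AlgEquiv.restrictNormal_commutes g' M x⟩
  have hinv (g : q.Gal) (x : M) : v (g • x) = v x := by
    obtain ⟨g', hg'⟩ := hcomm g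
    refine NNReal.eq ?_
    change padicAbs p Ω (algebraMap M Ω (g • x)) = padicAbs p Ω (algebraMap M Ω x)
    rw [hg']
    exact padicAbs_algEquiv K (g'.restrictScalars K) _
  have hfixF (g : q.Gal) (c : F) : g • algebraMap F M c = algebraMap F M c :=
    AlgEquiv.commutes (show M ≃ₐ[F] M from g) c
  have : Nonempty (q.rootSet M) := by
    rw [← Fintype.card_pos_iff, card_rootSet_eq_natDegree hqsep hMspl, hqdeg]
    exact hpp.pos
  have hfaith : FaithfulSMul q.Gal (q.rootSet M) := ⟨fun {g g'} h ↦ Gal.ext q fun x hx ↦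
    congrArg Subtype.val (h ⟨x, hx⟩)⟩
  refine nonempty_mulEquiv_frobeniusGroup_of_valuation v (ι := q.rootSet M) ?_ ?_ Subtype.val
    Subtype.val_injective (fun g i ↦ rfl) ?_ hinv ?_ hϖ0 hϖ1 ?_ ?_ hgcd
  · rw [Nat.card_eq_fintype_card, card_rootSet_eq_natDegree hqsep hMspl, hqdeg]
  · have := Gal.prime_degree_dvd_card hirr (hqdeg ▸ hpp)
    rwa [hqdeg] at this
  · change padicAbs p Ω (algebraMap M Ω p) < 1
    rw [map_natCast]
    exact padicAbs_natCast_prime_lt_one p Ω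
  · intro g x hx
    -- Triviality on residues: `x` is congruent to some `c` in the base field, and `g` fixes `c`.
    obtain ⟨c, hc, hlt⟩ := exists_maxUnramified_padicAbs_sub_lt (p := p)
      (x := algebraMap M Ω x) hx
    have hxc : v (x - algebraMap F M ⟨c, hc⟩) < 1 := by
      change padicAbs p Ω (algebraMap M Ω (x - algebraMap F M ⟨c, hc⟩)) < 1
      rwa [map_sub, ← IsScalarTower.algebraMap_apply F M Ω]
    have : g • x - x = g • (x - algebraMap F M ⟨c, hc⟩) - (x - algebraMap F M ⟨c, hc⟩) := by
      rw [smul_sub, hfixF]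
      ring
    rw [this]
    refine (v.map_sub _ _).trans_lt (max_lt ?_ hxc)
    rwa [hinv]
  · intro x hx0 hx
    have : IsGalois F M := IsGalois.of_separable_splitting_field hqsep
    obtain ⟨c, rfl⟩ := (IsGalois.mem_bot_iff_fixed x).2 hx
    have := hF (c : Ω) c.2 (by
      rintro h0
      rw [show c = 0 from Subtype.ext h0] at hx0
      simp at hx0)
    obtain ⟨n, hn⟩ := this
    refine ⟨n, hn ▸ ?_⟩
    change padicValuation p Ω (algebraMap M Ω (algebraMap F M c)) = _
    rw [← IsScalarTower.algebraMap_apply F M Ω]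
    rfl
  · rw [← valuation_discr v _ (map_eq_prod_rootSet hqmon hqsep hMspl),
      discr_map_of_monic _ hqmon (hqdeg ▸ hpp.pos), discr_map_of_monic _ hmon (hdeg ▸ hpp.pos),
      ← hK _ hd0]
    change padicValuation p Ω (algebraMap M Ω (algebraMap F M (algebraMap K F f.discr))) = _
    rw [← IsScalarTower.algebraMap_apply F M Ω, ← IsScalarTower.algebraMap_apply K F Ω]

end main

end LocalFieldExt

theorem proposition2p2 (p : ℕ) [Fact p.Prime] (hp : Odd p)
    (K : Type*) [Field K] [Algebra ℚ_[p] K] [FiniteDimensional ℚ_[p] K]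
    (f : K[X]) (hmonic : f.Monic) (hsqfree : Squarefree f) (hdeg : f.natDegree = p)
    (hirr : Irreducible f)
    (hgcd : Int.gcd (LocalFieldExt.normalizedVal p K f.discr) ((p : ℤ) - 1) = 1) :
    Nonempty ((f.map (algebraMap K (LocalFieldExt.maxUnramified p K))).Gal ≃*
        LocalFieldExt.FrobeniusGroup p) ∧
      Odd (LocalFieldExt.normalizedVal p K f.discr) := by
  have hodd : Odd (LocalFieldExt.normalizedVal p K f.discr) := by
    rw [← Int.not_even_iff_odd]
    intro heven
    -- Oddness of `p` enters here: an even valuation would share the factor 2 with `p - 1`.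
    have h2 : (2 : ℤ) ∣ (p : ℤ) - 1 := by
      obtain ⟨m, rfl⟩ := hp
      exact ⟨m, by push_cast; ring⟩
    have := Int.dvd_coe_gcd heven.two_dvd h2
    rw [hgcd] at this
    norm_num at this
  refine ⟨?_, hodd⟩
  have := LocalFieldExt.charZero_of_padic p K
  have hsep : f.Separable := hirr.separable
  have hpp : f.natDegree.Prime := hdeg ▸ Fact.out
  -- A zero discriminant would have the junk valuation 0, which is not odd.
  have hd0 : f.discr ≠ 0 := by
    intro h0
    rw [h0] at hodd
    simp [LocalFieldExt.normalizedVal] at hodd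
  rcases LocalFieldExt.irreducible_map_or_rootSet_subset hirr hmonic hsep
    (IsAlgClosed.splits _) hpp (LocalFieldExt.maxUnramified p K) with h | h
  · exact LocalFieldExt.nonempty_gal_mulEquiv_frobeniusGroup hmonic hdeg h hd0 hgcd
  · exact absurd (LocalFieldExt.even_normalizedVal_discr_of_rootSet_subset hmonic hsep
      hpp.pos h) (Int.not_even_iff_odd.2 hodd)
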